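/- For $p\in\{1,2\}$ let $\|\cdot\|_p$ denote the Schatten $p$-norm on complex square matrices. For a $C^2$ function $g\colon\mathbb R\to\mathbb R$ with bounded second derivative put $$g^{[1]}(x_0,x_1)=\begin{cases}\dfrac{g(x_0)-g(x_1)}{x_0-x_1},&x_0\ne x_1,\\ g'(x_0),&x_0=x_1,\end{cases}\qquad g^{[2]}(x_0,x_1,x_2)=\begin{cases}\dfrac{g^{[1]}(x_0,x_1)-g^{[1]}(x_1,x_2)}{x_0-x_2},&x_0\ne x_2,\\ \dfrac{d}{dx_0}\,g^{[1]}(x_0,x_1),&x_0=x_2.\end{cases}$$ For Hermitian $A_0,A_1,A_2\in M_d(\mathbb C)$ with orthonormal bases of eigenvectors $(\xi^{(l)}_i)_{i=1}^d$ and corresponding eigenvalues $(\lambda^{(l)}_i)_{i=1}^d$ ($l=0,1,2$), and for a bounded Borel function $\psi\colon\mathbb R^3\to\mathbb C$, put $$T_\psi^{A_0,A_1,A_2}(X,Y)=\sum_{i,j,k=1}^d\psi\bigl(\lambda^{(0)}_i,\lambda^{(1)}_k,\lambda^{(2)}_j\bigr)\,P_{\xi^{(0)}_i}XP_{\xi^{(1)}_k}YP_{\xi^{(2)}_j},\qquad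 X,Y\in M_d(\mathbb C),$$ where $P_\xi$ is the orthogonal projection onto the span of $\xi$ (the value does not depend on the choice of the eigenbases). \textbf{Lemma.} There exist a constant $c>0$, a $C^2$ function $g\colon\mathbb R\to\mathbb R$ with bounded second derivative, satisfying $g(x)=x|x|$ for $|x|>1$ and $g(0)=g'(0)=g''(0)=0$, and an integer $N\ge1$ such that for every sequence $(\alpha_n)_{n\ge N}$ of positive real numbers there are sequences of Hermitian matrices $\tilde A_n,\tilde B_n\in M_{8n+4}(\mathbb C)$, $n\ge N$, with $$\|\tilde B_n\|_2\le4\alpha_n\qquad\text{and}\qquad\bigl\|T_{g^{[2]}}^{\tilde A_n+\tilde B_n,\tilde A_n,\tilde A_n}(\tilde B_n,\tilde B_n)\bigr\|_1\ge c\,\alpha_n^2\log n\qquad\text{for all }n\ge N.$$ -/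

import Mathlib

noncomputable section

/-- First divided difference `f^[1]` of a differentiable function `f : ℝ → ℝ`. -/
def dividedDiff1 (f : ℝ → ℝ) (x₀ x₁ : ℝ) : ℝ :=
  if x₀ = x₁ then deriv f x₀ else (f x₀ - f x₁) / (x₀ - x₁)

/-- Second divided difference `f^[2]` of a `C²` function `f : ℝ → ℝ`. On `x₀ = x₂` it is the
derivative of `t ↦ f^[1](t, x₁)` at `t = x₀`. -/
def dividedDiff2 (f : ℝ → ℝ) (x₀ x₁ x₂ : ℝ) : ℝ :=
  if x₀ = x₂ then deriv (fun t => dividedDiff1 f t x₁) x₀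
  else (dividedDiff1 f x₀ x₁ - dividedDiff1 f x₁ x₂) / (x₀ - x₂)

/-- The Schatten norm `‖X‖_p = (∑ s_i(X)^p)^(1/p)` of a square complex matrix (`1 ≤ p < ∞`),
where the `s_i(X)` are the singular values of `X` on Euclidean space. -/
def schattenNorm {m : Type*} [Fintype m] [DecidableEq m] (p : ℝ) (X : Matrix m m ℂ) : ℝ :=
  (∑ i ∈ Finset.range (Fintype.card m), (Matrix.toEuclideanLin X).singularValues i ^ p) ^ (1 / p)

/-- The matrix of the rank one projection `P_ξ`, `P_ξ(y) = ⟨y, ξ⟩ ξ` (inner product linear in its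
first variable), onto the span of a unit vector `ξ`. -/
def rankOneProj {m : Type*} (ξ : EuclideanSpace ℂ m) : Matrix m m ℂ :=
  Matrix.of fun r s => ξ r * star (ξ s)

/-- The bilinear Schur multiplier associated with `ψ` and Hermitian matrices `A₀, A₁, A₂`:
`T_ψ^{A₀,A₁,A₂}(X, Y) = ∑_{i,k,j} ψ(λ_i⁽⁰⁾, λ_k⁽¹⁾, λ_j⁽²⁾) P_{ξ_i⁽⁰⁾} X P_{ξ_k⁽¹⁾} Y P_{ξ_j⁽²⁾}`,
where `ξ⁽⁰⁾, ξ⁽¹⁾, ξ⁽²⁾` are orthonormal bases of eigenvectors of `A₀, A₁, A₂` with eigenvalues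
`λ⁽⁰⁾, λ⁽¹⁾, λ⁽²⁾` (the value does not depend on the choice of the bases). -/
def bilinearSchurMultiplier {m : Type*} [Fintype m] [DecidableEq m] (ψ : ℝ → ℝ → ℝ → ℂ)
    {A₀ A₁ A₂ : Matrix m m ℂ} (h₀ : A₀.IsHermitian) (h₁ : A₁.IsHermitian) (h₂ : A₂.IsHermitian)
    (X Y : Matrix m m ℂ) : Matrix m m ℂ :=
  ∑ i, ∑ k, ∑ j, ψ (h₀.eigenvalues i) (h₁.eigenvalues k) (h₂.eigenvalues j) •
    (rankOneProj (h₀.eigenvectorBasis i) * X * rankOneProj (h₁.eigenvectorBasis k) * Y *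
      rankOneProj (h₂.eigenvectorBasis j))

end

open Matrix

/-! The failure of the bound is that of triangular truncation on the trace class. Since `g` is
`x|x|` for `|x| > 1`, for `y, a > 1` one has `g^[2](y, 0, -a) = (y - a)/(y + a)`, which is close to
`sign (p - q)` when `y = t^(p+1)`, `a = t^(q+1)` and `t` is large.

Let `A` be diagonal with eigenvalue `0` at `e_o` and eigenvalues `t^(p+1)` and `-t^(q+1)` for `p, q
< n`, and let `B` link `e_o` to each of these `2n` vectors with weight `β`. Then `B e_j = β e_o` and
`B e_o = v`, so column `j` of the multiplier is `β F(A + B) v` with `F(x) = g^[2](x, 0, -a)`. The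
eigenvectors of `A + B` are unknown, but `(A + B) e_i - μ_i e_i = β e_o` stays bounded while `F`
varies on the scale `a ≥ t`; hence the entry is `β² sign (p - q) + O(1/t)`
(`norm_bilinearSchurMultiplier_arrowMatrix_sub_le`).

The sign matrix is diagonalised by powers of the `n`-th roots of `-1`, with eigenvalues of size
about `n/k`, so its trace norm is at least of order `n log n` (`mul_log_sub_le_schattenNorm_one`).
With `β² = 4α²/n` this gives `α² log n`. -/

/-! ### Schatten norms -/

lemma exists_orthonormalBasis_norm_eq_singularValues {m : Type*} [Fintype m] [DecidableEq m]
    (X : Matrix m m ℂ) :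
    ∃ b : OrthonormalBasis (Fin (Fintype.card m)) ℂ (EuclideanSpace ℂ m),
      ∀ i : Fin (Fintype.card m),
        ‖Matrix.toEuclideanLin X (b i)‖ = (Matrix.toEuclideanLin X).singularValues i := by
  set T := Matrix.toEuclideanLin X
  have hn : Module.finrank ℂ (EuclideanSpace ℂ m) = Fintype.card m := finrank_euclideanSpace
  refine ⟨T.isSymmetric_adjoint_comp_self.eigenvectorBasis hn, fun i => ?_⟩
  set b := T.isSymmetric_adjoint_comp_self.eigenvectorBasis hn
  have h1 : ‖T (b i)‖ ^ 2 = T.singularValues i ^ 2 := by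
    rw [T.sq_singularValues_fin hn, ← Complex.ofReal_inj]
    have h2 := T.isSymmetric_adjoint_comp_self.apply_eigenvectorBasis hn i
    have h3 : inner ℂ (b i) ((LinearMap.adjoint T ∘ₗ T) (b i)) = inner ℂ (T (b i)) (T (b i)) := by
      rw [LinearMap.comp_apply, LinearMap.adjoint_inner_right]
    rw [h2, inner_smul_right, inner_self_eq_norm_sq_to_K, inner_self_eq_norm_sq_to_K,
      b.orthonormal.1 i] at h3
    simpa using h3.symm
  exact (sq_eq_sq₀ (norm_nonneg _) (T.singularValues_nonneg _)).1 h1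

lemma schattenNorm_two {m : Type*} [Fintype m] [DecidableEq m] (X : Matrix m m ℂ) :
    schattenNorm 2 X = √(∑ r, ∑ s, ‖X r s‖ ^ 2) := by
  obtain ⟨b, hb⟩ := exists_orthonormalBasis_norm_eq_singularValues X
  have hrow (r : m) (i) : Matrix.toEuclideanLin X (b i) r =
      inner ℂ (WithLp.toLp 2 (fun s => star (X r s)) : EuclideanSpace ℂ m) (b i) := by
    simp [Matrix.toLpLin_apply, Matrix.mulVec, dotProduct, PiLp.inner_apply, mul_comm]
  rw [schattenNorm, Real.sqrt_eq_rpow, Finset.sum_range]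
  congr 1
  simp only [Real.rpow_ofNat, ← hb, EuclideanSpace.norm_sq_eq]
  rw [Finset.sum_comm]
  refine Finset.sum_congr rfl fun r _ => ?_
  simp only [hrow, b.sum_sq_norm_inner_left, EuclideanSpace.norm_sq_eq]
  simp

lemma sum_norm_inner_mul_norm_inner_le {κ E : Type*} [Fintype κ] [NormedAddCommGroup E]
    [InnerProductSpace ℂ E] {u w : κ → E} (hu : Orthonormal ℂ u) (hw : Orthonormal ℂ w) (x y : E) :
    ∑ k, ‖inner ℂ (u k) x‖ * ‖inner ℂ (w k) y‖ ≤ ‖x‖ * ‖y‖ := by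
  have h1 : √(∑ k, ‖inner ℂ (u k) x‖ ^ 2) ≤ ‖x‖ :=
    Real.sqrt_le_iff.2 ⟨norm_nonneg _, hu.sum_inner_products_le x⟩
  have h2 : √(∑ k, ‖inner ℂ (w k) y‖ ^ 2) ≤ ‖y‖ :=
    Real.sqrt_le_iff.2 ⟨norm_nonneg _, hw.sum_inner_products_le y⟩
  exact (Real.sum_mul_le_sqrt_mul_sqrt _ _ _).trans
    (mul_le_mul h1 h2 (Real.sqrt_nonneg _) (norm_nonneg _))

/-- Duality lower bound for the trace norm. -/
lemma sum_norm_inner_le_schattenNorm_one {m κ : Type*} [Fintype m] [DecidableEq m] [Fintype κ]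
    (X : Matrix m m ℂ) {u w : κ → EuclideanSpace ℂ m} (hu : Orthonormal ℂ u)
    (hw : Orthonormal ℂ w) :
    ∑ k, ‖inner ℂ (u k) (Matrix.toEuclideanLin X (w k))‖ ≤ schattenNorm 1 X := by
  obtain ⟨b, hb⟩ := exists_orthonormalBasis_norm_eq_singularValues X
  rw [schattenNorm, Finset.sum_range]
  simp only [Real.rpow_one, ne_eq, one_ne_zero, not_false_eq_true, div_self, ← hb]
  calc ∑ k, ‖inner ℂ (u k) (Matrix.toEuclideanLin X (w k))‖
      ≤ ∑ k, ∑ i, ‖inner ℂ (u k) (Matrix.toEuclideanLin X (b i))‖ * ‖inner ℂ (w k) (b i)‖ := by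
        refine Finset.sum_le_sum fun k _ => ?_
        conv_lhs => rw [← b.sum_repr' (w k)]
        rw [map_sum, inner_sum]
        refine (norm_sum_le _ _).trans (Finset.sum_le_sum fun i _ => ?_)
        rw [map_smul, inner_smul_right, norm_mul, mul_comm, norm_inner_symm (b i)]
    _ = ∑ i, ∑ k, ‖inner ℂ (u k) (Matrix.toEuclideanLin X (b i))‖ * ‖inner ℂ (w k) (b i)‖ :=
        Finset.sum_comm
    _ ≤ ∑ i, ‖Matrix.toEuclideanLin X (b i)‖ := by
        refine Finset.sum_le_sum fun i _ => ?_
        simpa [b.orthonormal.1 i] using sum_norm_inner_mul_norm_inner_le hu hw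
          (Matrix.toEuclideanLin X (b i)) (b i)

/-! ### The function `g` and its second divided differences -/

/-- A `C²` function that agrees with `x ↦ x * |x|` for `|x| > 1` and vanishes near `0`, and whose
modulus is at most `x ^ 2`. -/
lemma exists_contDiff_eq_mul_abs :
    ∃ g : ℝ → ℝ, ContDiff ℝ 2 g ∧ (∃ M : ℝ, ∀ x, |iteratedDeriv 2 g x| ≤ M) ∧
      (∀ x, 1 < |x| → g x = x * |x|) ∧ (∀ x, |g x| ≤ x ^ 2) ∧
      g 0 = 0 ∧ deriv g 0 = 0 ∧ iteratedDeriv 2 g 0 = 0 := by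
  -- The radii `1/2` and `1` make `g` vanish near `0`, where `x|x|` is not `C²`, and leave `x|x|`
  -- unchanged for `|x| > 1`.
  let φ : ContDiffBump (0 : ℝ) := ⟨1 / 2, 1, by norm_num, by norm_num⟩
  let g : ℝ → ℝ := fun x => x * |x| * (1 - φ x)
  have hg0 : g =ᶠ[nhds 0] fun _ => 0 := by
    filter_upwards [Metric.closedBall_mem_nhds (0 : ℝ) (show (0:ℝ) < 1 / 2 by norm_num)] with x hx
    simp [g, φ.one_of_mem_closedBall hx]
  have hout : ∀ x, 1 < |x| → g x = x * |x| := by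
    intro x hx
    have : φ x = 0 := φ.zero_of_le_dist (by simpa [φ] using hx.le)
    simp [g, this]
  have hC : ContDiff ℝ 2 g := by
    rw [contDiff_iff_contDiffAt]
    intro x
    rcases eq_or_ne x 0 with rfl | hx
    · exact contDiffAt_const.congr_of_eventuallyEq hg0
    · exact (contDiffAt_id.mul (contDiffAt_abs hx)).mul
        (contDiffAt_const.sub φ.contDiffAt)
  have hpos : ∀ x, 1 < x → iteratedDeriv 2 g x = 2 := by
    intro x hx
    have h : g =ᶠ[nhds x] fun y => y ^ 2 := by
      filter_upwards [lt_mem_nhds hx] with y hy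
      rw [hout y (lt_of_lt_of_le hy (le_abs_self y)), abs_of_pos (by linarith)]; ring
    rw [h.iteratedDeriv_eq]
    simp
  have hneg : ∀ x, x < -1 → iteratedDeriv 2 g x = -2 := by
    intro x hx
    have h : g =ᶠ[nhds x] fun y => -y ^ 2 := by
      filter_upwards [gt_mem_nhds hx] with y hy
      rw [hout y (by rw [abs_of_neg (by linarith)]; linarith), abs_of_neg (by linarith)]; ring
    rw [h.iteratedDeriv_eq]
    simp
  refine ⟨g, hC, ?_, hout, ?_, by simp [g], ?_, ?_⟩
  -- The second derivative is `±2` outside `[-1, 1]` and bounded on this compact interval by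
  -- continuity.
  · obtain ⟨M, hM⟩ := (isCompact_Icc (a := (-1 : ℝ)) (b := 1)).exists_bound_of_continuousOn
      (hC.continuous_iteratedDeriv 2 le_rfl).continuousOn
    refine ⟨max M 2, fun x => ?_⟩
    rcases lt_or_ge x (-1) with h | h
    · rw [hneg x h]; simp
    rcases lt_or_ge 1 x with h' | h'
    · rw [hpos x h']; simp
    exact (hM x ⟨h, h'⟩).trans (le_max_left _ _)
  · intro x
    have h1 : |1 - φ x| ≤ 1 := by
      rw [abs_le]; constructor <;> linarith [φ.nonneg (x := x), φ.le_one (x := x)]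
    calc |g x| = x ^ 2 * |1 - φ x| := by simp [g, abs_mul, ← sq]
      _ ≤ x ^ 2 * 1 := by gcongr
      _ = x ^ 2 := mul_one _
  · rw [hg0.deriv_eq]; simp
  · rw [hg0.iteratedDeriv_eq]; simp

lemma dividedDiff2_zero_neg_of_ne {g : ℝ → ℝ} (hout : ∀ x, 1 < |x| → g x = x * |x|)
    (h0 : g 0 = 0) {a x : ℝ} (ha : 1 < a) (hx : x ≠ -a) :
    dividedDiff2 g x 0 (-a) = (dividedDiff1 g x 0 - a) / (x + a) := by
  have h1 : dividedDiff1 g 0 (-a) = a := by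
    have ha' : |(-a)| = a := by rw [abs_neg, abs_of_pos (by linarith)]
    rw [dividedDiff1, if_neg (by linarith), h0, hout (-a) (by rw [ha']; exact ha), ha',
      div_eq_iff (by linarith)]
    ring
  rw [dividedDiff2, if_neg hx, h1, sub_neg_eq_add]

lemma dividedDiff1_zero_of_one_lt_abs {g : ℝ → ℝ} (hout : ∀ x, 1 < |x| → g x = x * |x|)
    (h0 : g 0 = 0) {x : ℝ} (hx : 1 < |x|) : dividedDiff1 g x 0 = |x| := by
  have hx0 : x ≠ 0 := by rintro rfl; simp at hx; linarith
  rw [dividedDiff1, if_neg hx0, h0, hout x hx]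
  field_simp
  ring

lemma abs_dividedDiff1_zero_le {g : ℝ → ℝ} (hsq : ∀ x, |g x| ≤ x ^ 2)
    (h0 : g 0 = 0) (h1 : deriv g 0 = 0) (x : ℝ) : |dividedDiff1 g x 0| ≤ |x| := by
  rcases eq_or_ne x 0 with rfl | hx
  · simp [dividedDiff1, h1]
  · rw [dividedDiff1, if_neg hx, h0, sub_zero, sub_zero, abs_div, div_le_iff₀ (abs_pos.2 hx)]
    simpa [← sq] using hsq x

/-- On `x < -1` the function `g^[1](x, 0) = -x` is affine with slope `-1`, so the coincidence point
`x = -a` causes no jump. -/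
lemma dividedDiff2_zero_neg_of_lt {g : ℝ → ℝ} (hout : ∀ x, 1 < |x| → g x = x * |x|)
    (h0 : g 0 = 0) {a x : ℝ} (ha : 1 < a) (hx : x < -1) :
    dividedDiff2 g x 0 (-a) = -1 := by
  rcases eq_or_ne x (-a) with rfl | hxa
  · rw [dividedDiff2, if_pos rfl]
    have h : (fun t => dividedDiff1 g t 0) =ᶠ[nhds (-a)] fun t => -t := by
      filter_upwards [gt_mem_nhds hx] with y hy
      rw [dividedDiff1_zero_of_one_lt_abs hout h0 (by rw [abs_of_neg (by linarith)]; linarith),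
        abs_of_neg (by linarith)]
    rw [h.deriv_eq]
    simp
  · rw [dividedDiff2_zero_neg_of_ne hout h0 ha hxa,
      dividedDiff1_zero_of_one_lt_abs hout h0 (by rw [abs_of_neg (by linarith)]; linarith),
      abs_of_neg (by linarith), div_eq_iff (fun h => hxa (by linarith))]
    ring

/-- For `a, y > 0` the second divided difference `g^[2](x, 0, -a)` is close to
`(y - a) / (y + a)` if `x` is close to `y` on the scale of `a`. -/
lemma abs_dividedDiff2_sub_le {g : ℝ → ℝ} (hout : ∀ x, 1 < |x| → g x = x * |x|)
    (hsq : ∀ x, |g x| ≤ x ^ 2) (h0 : g 0 = 0) (h1 : deriv g 0 = 0) {a x y : ℝ} (ha : 2 ≤ a)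
    (hy : 0 < y) :
    |dividedDiff2 g x 0 (-a) - (y - a) / (y + a)| ≤ 4 / a * (|x - y| + 1) := by
  have ha0 : 0 < a := by linarith
  rcases lt_or_ge x (-1) with hx | hx
  · rw [dividedDiff2_zero_neg_of_lt hout h0 (by linarith) hx]
    have e : -1 - (y - a) / (y + a) = -(2 * y / (y + a)) := by field_simp; ring
    -- Here `x < 0 < y`, so `y ≤ |x - y|` and the error `2y/(y + a)` is absorbed by the linear term.
    rw [e, abs_neg, abs_of_pos (by positivity), div_mul_eq_mul_div,
      div_le_div_iff₀ (by positivity) ha0]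
    have : y ≤ |x - y| := by rw [abs_sub_comm]; exact le_trans (by linarith) (le_abs_self _)
    nlinarith [mul_pos hy ha0, mul_nonneg (sub_nonneg.2 this) hy.le,
      mul_nonneg (sub_nonneg.2 this) ha0.le]
  have hxa : x ≠ -a := by intro h; linarith
  have hxa' : 0 < x + a := by linarith
  rw [dividedDiff2_zero_neg_of_ne hout h0 (by linarith) hxa]
  -- `d` stands for `g^[1](x, 0)`: it equals `x` for `x > 1`, and lies within `2` of `x` for `|x| ≤
  -- 1`, where `g` is only known through `|g x| ≤ x²`. The denominator satisfies `x + a ≥ a/2`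
  -- because `x ≥ -1` and `a ≥ 2`.
  have key : ∀ d : ℝ, |d - x| ≤ 2 →
      |(d - a) / (x + a) - (y - a) / (y + a)| ≤ 4 / a * (|x - y| + 1) := by
    intro d hd
    have e : (d - a) / (x + a) - (y - a) / (y + a)
        = (d - x) / (x + a) + 2 * a * (x - y) / ((x + a) * (y + a)) := by
      field_simp; ring
    have b1 : |(d - x) / (x + a)| ≤ 4 / a := by
      rw [abs_div, abs_of_pos hxa', div_le_div_iff₀ hxa' ha0]
      nlinarith [abs_nonneg (d - x)]
    have b2 : |2 * a * (x - y) / ((x + a) * (y + a))| ≤ 4 / a * |x - y| := by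
      rw [abs_div, abs_mul, abs_of_pos (show 0 < 2 * a by linarith),
        abs_of_pos (mul_pos hxa' (by linarith)), div_mul_eq_mul_div,
        div_le_div_iff₀ (mul_pos hxa' (by linarith)) ha0]
      have : a * a ≤ 2 * ((x + a) * (y + a)) := by
        nlinarith [mul_pos hxa' hy, mul_nonneg ha0.le (show 0 ≤ 2 * (x + a) - a by linarith)]
      nlinarith [abs_nonneg (x - y), mul_le_mul_of_nonneg_left this (abs_nonneg (x - y))]
    rw [e]
    calc _ ≤ _ := abs_add_le _ _
      _ ≤ 4 / a + 4 / a * |x - y| := add_le_add b1 b2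
      _ = _ := by ring
  apply key
  rcases lt_or_ge 1 |x| with h | h
  · have hx1 : 0 ≤ x := by
      by_contra hneg
      rw [abs_of_neg (by linarith)] at h
      linarith
    rw [dividedDiff1_zero_of_one_lt_abs hout h0 h, abs_of_nonneg hx1]
    simp
  · have := abs_dividedDiff1_zero_le hsq h0 h1 x
    exact (abs_sub _ _).trans (by linarith)

/-! ### Schur multipliers acting on exact and approximate eigenvectors -/

lemma rankOneProj_mulVec {m : Type*} [Fintype m] (ξ : EuclideanSpace ℂ m) (y : m → ℂ) :
    rankOneProj ξ *ᵥ y = inner ℂ ξ (WithLp.toLp 2 y) • ξ.ofLp := by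
  ext r
  simp only [rankOneProj, Matrix.mulVec, dotProduct, Matrix.of_apply, PiLp.inner_apply,
    Pi.smul_apply, smul_eq_mul, Finset.sum_mul]
  refine Finset.sum_congr rfl fun s _ => ?_
  simp
  ring

section

variable {m : Type*} [Fintype m] [DecidableEq m]

lemma inner_eigenvectorBasis_mulVec {A : Matrix m m ℂ} (hA : A.IsHermitian) (k : m) (y : m → ℂ) :
    inner ℂ (hA.eigenvectorBasis k) (WithLp.toLp 2 (A *ᵥ y)) =
      hA.eigenvalues k * inner ℂ (hA.eigenvectorBasis k) (WithLp.toLp 2 y) := by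
  have h1 := Matrix.isSymmetric_toEuclideanLin_iff.mpr hA (hA.eigenvectorBasis k)
    (WithLp.toLp 2 y)
  simp only [Matrix.toLpLin_apply, hA.mulVec_eigenvectorBasis] at h1
  rw [← h1]
  have : (WithLp.toLp 2 (hA.eigenvalues k • (hA.eigenvectorBasis k).ofLp) : EuclideanSpace ℂ m) =
      (hA.eigenvalues k : ℂ) • hA.eigenvectorBasis k := by
    ext; simp
  rw [this, inner_smul_left]
  simp

/-- The sum is `F(A) y`: the components of `y` along eigenvectors for eigenvalues other than `μ`
vanish. The arbitrarily chosen basis `eigenvectorBasis` thus drops out. -/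
lemma sum_smul_rankOneProj_mulVec {A : Matrix m m ℂ} (hA : A.IsHermitian) (F : ℝ → ℂ)
    {y : m → ℂ} {μ : ℝ} (hy : A *ᵥ y = (μ : ℂ) • y) :
    ∑ k, F (hA.eigenvalues k) • (rankOneProj (hA.eigenvectorBasis k) *ᵥ y) = F μ • y := by
  have h1 : ∀ k, F (hA.eigenvalues k) • (rankOneProj (hA.eigenvectorBasis k) *ᵥ y) =
      F μ • (inner ℂ (hA.eigenvectorBasis k) (WithLp.toLp 2 y) • hA.eigenvectorBasis k).ofLp := by
    intro k
    rw [rankOneProj_mulVec, WithLp.ofLp_smul]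
    by_cases h : hA.eigenvalues k = μ
    · rw [h]
    · have h2 := inner_eigenvectorBasis_mulVec hA k y
      rw [hy, WithLp.toLp_smul, inner_smul_right] at h2
      have h3 : inner ℂ (hA.eigenvectorBasis k) (WithLp.toLp 2 y) = 0 := by
        by_contra h4
        exact h (by exact_mod_cast (mul_right_cancel₀ h4 h2).symm)
      simp [h3]
  rw [Finset.sum_congr rfl fun k _ => h1 k, ← Finset.smul_sum, ← WithLp.ofLp_sum,
    hA.eigenvectorBasis.sum_repr']

/-- Evaluation of a bilinear Schur multiplier on an eigenvector of `A₂` that `Y` maps to a multiple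
of an eigenvector of `A₁`. -/
lemma bilinearSchurMultiplier_mulVec (ψ : ℝ → ℝ → ℝ → ℂ) {A₀ A₁ A₂ : Matrix m m ℂ}
    (h₀ : A₀.IsHermitian) (h₁ : A₁.IsHermitian) (h₂ : A₂.IsHermitian) (X Y : Matrix m m ℂ)
    {y z : m → ℂ} {μ ν : ℝ} {c : ℂ} (hy : A₂ *ᵥ y = (μ : ℂ) • y) (hYy : Y *ᵥ y = c • z)
    (hz : A₁ *ᵥ z = (ν : ℂ) • z) :
    bilinearSchurMultiplier ψ h₀ h₁ h₂ X Y *ᵥ y =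
      c • ∑ i, ψ (h₀.eigenvalues i) ν μ •
        (rankOneProj (h₀.eigenvectorBasis i) *ᵥ (X *ᵥ z)) := by
  -- The sum over `j` collapses on the eigenvector `y`, which frees `Y y = c z`; the sum over `k`
  -- then collapses on `z`. The sum over `i` remains, as no eigenvector of `A₀` is given.
  have hj : ∀ i k, ∑ j, ψ (h₀.eigenvalues i) (h₁.eigenvalues k) (h₂.eigenvalues j) •
      ((rankOneProj (h₀.eigenvectorBasis i) * X * rankOneProj (h₁.eigenvectorBasis k) * Y *
        rankOneProj (h₂.eigenvectorBasis j)) *ᵥ y) =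
      ψ (h₀.eigenvalues i) (h₁.eigenvalues k) μ •
      (c • ((rankOneProj (h₀.eigenvectorBasis i) * X) *ᵥ
        (rankOneProj (h₁.eigenvectorBasis k) *ᵥ z))) := by
    intro i k
    have := congrArg (fun x => (rankOneProj (h₀.eigenvectorBasis i) * X *
      rankOneProj (h₁.eigenvectorBasis k) * Y) *ᵥ x)
      (sum_smul_rankOneProj_mulVec h₂ (ψ (h₀.eigenvalues i) (h₁.eigenvalues k)) hy)
    simp only [Matrix.mulVec_sum, Matrix.mulVec_smul, Matrix.mulVec_mulVec] at this
    rw [this, ← Matrix.mulVec_mulVec, hYy, Matrix.mulVec_smul, ← Matrix.mulVec_mulVec]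
  have hk : ∀ i, ∑ k, ψ (h₀.eigenvalues i) (h₁.eigenvalues k) μ •
      (c • ((rankOneProj (h₀.eigenvectorBasis i) * X) *ᵥ
        (rankOneProj (h₁.eigenvectorBasis k) *ᵥ z))) =
      c • (ψ (h₀.eigenvalues i) ν μ • (rankOneProj (h₀.eigenvectorBasis i) *ᵥ (X *ᵥ z))) := by
    intro i
    have := congrArg (fun x => c • ((rankOneProj (h₀.eigenvectorBasis i) * X) *ᵥ x))
      (sum_smul_rankOneProj_mulVec h₁ (fun t => ψ (h₀.eigenvalues i) t μ) hz)
    simp only [Matrix.mulVec_sum, Matrix.mulVec_smul, Finset.smul_sum] at this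
    rw [← Matrix.mulVec_mulVec] at this
    rw [← this]
    exact Finset.sum_congr rfl fun k _ => smul_comm _ _ _
  simp only [bilinearSchurMultiplier, Matrix.sum_mulVec, Matrix.smul_mulVec, hj, hk,
    Finset.smul_sum]

/-- If `F` is close to `s` near `μ` and `y` is nearly an eigenvector of `H` for `μ`, then
`⟨y, F(H) w⟩` is close to `s ⟨y, w⟩`. -/
lemma norm_inner_sum_smul_rankOneProj_sub_le {H : Matrix m m ℂ} (hH : H.IsHermitian) (F : ℝ → ℂ)
    (s : ℂ) {μ K : ℝ} (hF : ∀ x, ‖F x - s‖ ≤ K * (|x - μ| + 1)) (hK : 0 ≤ K) (y w : m → ℂ) :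
    ‖inner ℂ (WithLp.toLp 2 y) (WithLp.toLp 2
        (∑ i, F (hH.eigenvalues i) • (rankOneProj (hH.eigenvectorBasis i) *ᵥ w)))
        - s * inner ℂ (WithLp.toLp 2 y) (WithLp.toLp 2 w)‖ ≤
      K * ((‖(WithLp.toLp 2 (H *ᵥ y - (μ : ℂ) • y) : EuclideanSpace ℂ m)‖ +
        ‖(WithLp.toLp 2 y : EuclideanSpace ℂ m)‖) *
        ‖(WithLp.toLp 2 w : EuclideanSpace ℂ m)‖) := by
  set b := hH.eigenvectorBasis
  set y' : EuclideanSpace ℂ m := WithLp.toLp 2 y with hy'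
  set w' : EuclideanSpace ℂ m := WithLp.toLp 2 w with hw'
  set d : EuclideanSpace ℂ m := WithLp.toLp 2 (H *ᵥ y - (μ : ℂ) • y) with hd
  have h1 : inner ℂ y' (WithLp.toLp 2
      (∑ i, F (hH.eigenvalues i) • (rankOneProj (b i) *ᵥ w))) =
      ∑ i, F (hH.eigenvalues i) * (inner ℂ y' (b i) * inner ℂ (b i) w') := by
    simp only [WithLp.toLp_sum, WithLp.toLp_smul, rankOneProj_mulVec, inner_sum, inner_smul_right,
      WithLp.toLp_ofLp]
    exact Finset.sum_congr rfl fun i _ => by rw [mul_comm (inner ℂ y' (b i))]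
  -- The residual `d = H y - μ y` has coordinates `(λ_i - μ)⟨b_i, y⟩`, which absorbs the growth `|x
  -- - μ|` allowed in `hF`.
  have h2 : ∀ i, ‖inner ℂ (b i) d‖ = |hH.eigenvalues i - μ| * ‖inner ℂ (b i) y'‖ := by
    intro i
    rw [hd, WithLp.toLp_sub, inner_sub_right, inner_eigenvectorBasis_mulVec, WithLp.toLp_smul,
      inner_smul_right, ← sub_mul, norm_mul, ← Complex.ofReal_sub, Complex.norm_real,
      Real.norm_eq_abs]
  have h3 := sum_norm_inner_mul_norm_inner_le b.orthonormal b.orthonormal d w'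
  have h4 := sum_norm_inner_mul_norm_inner_le b.orthonormal b.orthonormal y' w'
  rw [h1, ← b.sum_inner_mul_inner y' w', Finset.mul_sum, ← Finset.sum_sub_distrib]
  calc _ ≤ ∑ i, ‖F (hH.eigenvalues i) * (inner ℂ y' (b i) * inner ℂ (b i) w') -
          s * (inner ℂ y' (b i) * inner ℂ (b i) w')‖ := norm_sum_le _ _
    _ ≤ ∑ i, K * (‖inner ℂ (b i) d‖ * ‖inner ℂ (b i) w'‖ +
          ‖inner ℂ (b i) y'‖ * ‖inner ℂ (b i) w'‖) := by
        refine Finset.sum_le_sum fun i _ => ?_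
        rw [← sub_mul, norm_mul, norm_mul, h2, norm_inner_symm y']
        calc _ ≤ K * (|hH.eigenvalues i - μ| + 1) *
              (‖inner ℂ (b i) y'‖ * ‖inner ℂ (b i) w'‖) := by gcongr; exact hF _
          _ = _ := by ring
    _ ≤ K * (‖d‖ * ‖w'‖ + ‖y'‖ * ‖w'‖) := by
        rw [← Finset.mul_sum, Finset.sum_add_distrib]
        gcongr
    _ = _ := by ring

end

/-! ### Trace norm of the sign matrix -/

/-- Powers of an `n`-th root of `-1` form an eigenvector of the matrix `sign (p - q)`. -/
lemma sum_sign_mul_pow {n : ℕ} {ω : ℂ} (hω : ω ^ n = -1) (hω1 : ω ≠ 1) (p : Fin n) :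
    ∑ q : Fin n, (SignType.sign ((p : ℤ) - (q : ℤ)) : ℂ) * ω ^ (q : ℕ) =
      (1 + ω) / (ω - 1) * ω ^ (p : ℕ) := by
  have hne : ω - 1 ≠ 0 := sub_ne_zero.2 hω1
  have h1 : ∑ q : Fin n, (SignType.sign ((p : ℤ) - (q : ℤ)) : ℂ) * ω ^ (q : ℕ) =
      ∑ q ∈ Finset.range n, (SignType.sign ((p : ℤ) - (q : ℤ)) : ℂ) * ω ^ q :=
    (Finset.sum_range fun q : ℕ => (SignType.sign ((p : ℤ) - (q : ℤ)) : ℂ) * ω ^ q).symm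
  have h2 : ∑ q ∈ Finset.range p, (SignType.sign ((p : ℤ) - (q : ℤ)) : ℂ) * ω ^ q =
      (ω ^ (p : ℕ) - 1) / (ω - 1) := by
    rw [← geom_sum_eq hω1]
    refine Finset.sum_congr rfl fun q hq => ?_
    have := Finset.mem_range.1 hq
    rw [sign_pos (by omega)]
    simp
  have h3 : ∑ q ∈ Finset.Ico (p + 1 : ℕ) n, (SignType.sign ((p : ℤ) - (q : ℤ)) : ℂ) * ω ^ q =
      -((ω ^ n - ω ^ (p + 1 : ℕ)) / (ω - 1)) := by
    rw [← geom_sum_Ico hω1 (by omega), ← Finset.sum_neg_distrib]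
    refine Finset.sum_congr rfl fun q hq => ?_
    have := Finset.mem_Ico.1 hq
    rw [sign_neg (by omega)]
    simp
  -- In the difference of the two geometric sums the constants `-1` and `-ω^n = 1` cancel.
  rw [h1, ← Finset.sum_range_add_sum_Ico _ (show (p + 1 : ℕ) ≤ n by omega),
    Finset.sum_range_succ, h2, h3, hω]
  simp only [sub_self, sign_zero, SignType.coe_zero, zero_mul, add_zero]
  field_simp
  ring

/-- The `k`-th of the `n`-th roots of `-1`. -/
noncomputable def rootNegOne (n k : ℕ) : ℂ := Complex.exp ((Real.pi * (2 * k + 1) / n : ℝ) * Complex.I)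

lemma rootNegOne_pow {n : ℕ} (hn : n ≠ 0) (k : ℕ) : rootNegOne n k ^ n = -1 := by
  rw [rootNegOne, ← Complex.exp_nat_mul]
  have : (n : ℂ) * (((Real.pi * (2 * k + 1) / n : ℝ) : ℂ) * Complex.I) =
      Real.pi * Complex.I + k * (2 * Real.pi * Complex.I) := by
    have : (n : ℂ) ≠ 0 := by exact_mod_cast hn
    push_cast
    field_simp
    ring
  rw [this, Complex.exp_add, Complex.exp_nat_mul_two_pi_mul_I, Complex.exp_pi_mul_I, mul_one]

lemma norm_rootNegOne (n k : ℕ) : ‖rootNegOne n k‖ = 1 := Complex.norm_exp_ofReal_mul_I _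

lemma rootNegOne_ne_one {n : ℕ} (hn : n ≠ 0) (k : ℕ) : rootNegOne n k ≠ 1 := by
  intro h
  have := rootNegOne_pow hn k
  rw [h, one_pow] at this
  norm_num at this

lemma rootNegOne_injOn {n k l : ℕ} (hk : k < n) (hl : l < n)
    (h : rootNegOne n k = rootNegOne n l) : k = l := by
  have hn : (n : ℂ) ≠ 0 := by exact_mod_cast (by omega : n ≠ 0)
  rw [rootNegOne, rootNegOne, Complex.exp_eq_exp_iff_exists_int] at h
  obtain ⟨z, hz⟩ := h
  have hpi : (Real.pi : ℂ) ≠ 0 := by exact_mod_cast Real.pi_ne_zero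
  have hz' : (k : ℂ) = l + z * n := by
    push_cast at hz
    field_simp at hz
    linear_combination hz / 2
  have hz2 : (k : ℤ) = l + z * n := by exact_mod_cast hz'
  have hz0 : z = 0 := by
    by_contra h0
    rcases lt_or_gt_of_ne h0 with h1 | h1
    · nlinarith
    · nlinarith
  simp only [hz0, zero_mul, add_zero] at hz2
  exact_mod_cast hz2

/-- For `k ≠ l` the ratio of the two roots is an `n`-th root of unity other than `1`, so the
geometric sum vanishes. -/
lemma sum_star_rootNegOne_pow_mul {n : ℕ} (k l : ℕ) (hk : k < n) (hl : l < n) :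
    ∑ p : Fin n, star (rootNegOne n k ^ (p : ℕ)) * rootNegOne n l ^ (p : ℕ) =
      if k = l then (n : ℂ) else 0 := by
  have hn : n ≠ 0 := by omega
  have hu : ∀ k, star (rootNegOne n k) * rootNegOne n k = 1 := by
    intro k
    have := Complex.conj_mul' (rootNegOne n k)
    rw [norm_rootNegOne] at this
    simpa using this
  split_ifs with h
  · subst h
    simp only [star_pow, ← mul_pow, hu, one_pow]
    simp
  · set ω := star (rootNegOne n k) * rootNegOne n l with hω
    have h1 : ω ≠ 1 := by
      intro h1
      apply h
      refine rootNegOne_injOn hk hl ?_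
      calc rootNegOne n k = rootNegOne n k * ω := by rw [h1, mul_one]
        _ = (star (rootNegOne n k) * rootNegOne n k) * rootNegOne n l := by rw [hω]; ring
        _ = _ := by rw [hu, one_mul]
    have h2 : ω ^ n = 1 := by
      rw [hω, mul_pow, ← star_pow, rootNegOne_pow hn, rootNegOne_pow hn]
      simp
    simp only [star_pow, ← mul_pow, ← hω]
    rw [← Finset.sum_range fun p => ω ^ p, geom_sum_eq h1, h2]
    simp

/-- The chord `|ω - 1|` is at most the arc `θ`, and `4(k + 1) ≤ n` forces `θ ≤ π/2`, whence `Re ω ≥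
0` and `|1 + ω| ≥ 1`. Replacing `2k + 1` by `2(k + 1)` prepares a harmonic sum. -/
lemma le_norm_one_add_rootNegOne_div {n k : ℕ} (hk : 4 * (k + 1) ≤ n) :
    n / (2 * Real.pi * (k + 1)) ≤ ‖(1 + rootNegOne n k) / (rootNegOne n k - 1)‖ := by
  have hn : (0 : ℝ) < n := by exact_mod_cast (by omega : 0 < n)
  set θ : ℝ := Real.pi * (2 * k + 1) / n with hθ
  have hθ0 : 0 < θ := by positivity
  have hk' : 4 * ((k : ℝ) + 1) ≤ n := by exact_mod_cast hk
  have hθ1 : θ ≤ Real.pi / 2 := by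
    rw [hθ, div_le_div_iff₀ hn (by norm_num)]
    nlinarith [Real.pi_pos]
  have h1 : ‖rootNegOne n k - 1‖ ≤ θ := by
    have := Real.norm_exp_I_mul_ofReal_sub_one_le (x := θ)
    rw [mul_comm, Real.norm_eq_abs, abs_of_pos hθ0] at this
    exact this
  have h2 : 1 ≤ ‖1 + rootNegOne n k‖ := by
    refine le_trans ?_ (Complex.re_le_norm _)
    have : (rootNegOne n k).re = Real.cos θ := Complex.exp_ofReal_mul_I_re θ
    rw [Complex.add_re, this, Complex.one_re]
    linarith [Real.cos_nonneg_of_mem_Icc (x := θ) ⟨by linarith [Real.pi_pos], hθ1⟩]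
  have h3 : 0 < ‖rootNegOne n k - 1‖ :=
    norm_pos_iff.2 (sub_ne_zero.2 (rootNegOne_ne_one (by omega) k))
  rw [norm_div]
  calc n / (2 * Real.pi * (k + 1)) ≤ 1 / θ := by
        rw [hθ, one_div_div]
        exact div_le_div_of_nonneg_left hn.le (by positivity) (by nlinarith [Real.pi_pos])
    _ ≤ _ := by gcongr

lemma mul_log_le_sum_norm {n : ℕ} (hn : 16 ≤ n) :
    n * Real.log n / (4 * Real.pi) ≤
      ∑ k : Fin (n / 4), ‖(1 + rootNegOne n k) / (rootNegOne n k - 1)‖ := by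
  have hn0 : (0 : ℝ) < n := by exact_mod_cast (by omega : 0 < n)
  have h1 : Real.log n / 2 ≤ (harmonic (n / 4) : ℝ) := by
    refine le_trans ?_ (log_add_one_le_harmonic _)
    have h2 : Real.log n ≤ Real.log (((n / 4 + 1 : ℕ) : ℝ) ^ 2) := by
      apply Real.log_le_log hn0
      -- Rounding down in `n / 4` is harmless: `n ≤ 4(n/4 + 1) ≤ (n/4 + 1)²` since `n ≥ 16`.
      have : n ≤ (n / 4 + 1) ^ 2 := by
        have : n ≤ 4 * (n / 4 + 1) := by omega
        have : 4 ≤ n / 4 + 1 := by omega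
        nlinarith
      exact_mod_cast this
    rw [Real.log_pow] at h2
    push_cast at h2 ⊢
    linarith
  calc n * Real.log n / (4 * Real.pi) = n / (2 * Real.pi) * (Real.log n / 2) := by
        field_simp; ring
    _ ≤ n / (2 * Real.pi) * harmonic (n / 4) := by gcongr
    _ = ∑ k : Fin (n / 4), n / (2 * Real.pi * ((k : ℕ) + 1)) := by
        rw [harmonic, Finset.sum_range]
        push_cast
        rw [Finset.mul_sum]
        refine Finset.sum_congr rfl fun k _ => ?_
        field_simp
    _ ≤ _ := Finset.sum_le_sum fun k _ => le_norm_one_add_rootNegOne_div (by omega)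

/-- A matrix with a block close to a multiple of `(sign (p - q))` has large trace norm. -/
lemma mul_log_sub_le_schattenNorm_one {m : Type*} [Fintype m] [DecidableEq m] {n : ℕ}
    (hn : 16 ≤ n) {pl mi : Fin n → m} (hpl : Function.Injective pl) (hmi : Function.Injective mi)
    (X : Matrix m m ℂ) {b E : ℝ} (hb : 0 ≤ b)
    (hX : ∀ p q, ‖X (pl p) (mi q) - b * (SignType.sign ((p : ℤ) - (q : ℤ)) : ℂ)‖ ≤ E) :
    b * (n * Real.log n / (4 * Real.pi)) - n ^ 2 * E ≤ schattenNorm 1 X := by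
  have hn0 : (0 : ℝ) < n := by exact_mod_cast (by omega : 0 < n)
  have hE : 0 ≤ E := (norm_nonneg _).trans (hX ⟨0, by omega⟩ ⟨0, by omega⟩)
  have hr : (√n : ℂ) * √n = n := by exact_mod_cast Real.mul_self_sqrt hn0.le
  have hr0 : (√n : ℂ) ≠ 0 := by exact_mod_cast (Real.sqrt_pos.2 hn0).ne'
  -- Normalised eigenvectors of the sign matrix, placed by `f` on the rows `pl` and on the columns
  -- `mi`, serve as test families in the duality bound.
  let c : Fin (n / 4) → Fin n → ℂ := fun k p => rootNegOne n k ^ (p : ℕ) / √n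
  let f : (Fin n → m) → Fin (n / 4) → EuclideanSpace ℂ m :=
    fun ι k => ∑ p, c k p • EuclideanSpace.basisFun m ℂ (ι p)
  have hortho : ∀ ι : Fin n → m, Function.Injective ι → Orthonormal ℂ (f ι) := by
    intro ι hι
    rw [orthonormal_iff_ite]
    intro k l
    refine (((EuclideanSpace.basisFun m ℂ).orthonormal.comp ι hι).inner_sum (c k) (c l)
      Finset.univ).trans ?_
    have h1 := sum_star_rootNegOne_pow_mul (n := n) k l (by omega) (by omega)
    have h2 : ∀ p : Fin n, (starRingEnd ℂ) (c k p) * c l p =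
        star (rootNegOne n k ^ (p : ℕ)) * rootNegOne n l ^ (p : ℕ) / n := by
      intro p
      simp only [c, map_div₀, Complex.conj_ofReal, ← hr]
      rw [div_mul_div_comm]
      rfl
    rw [Finset.sum_congr rfl fun p _ => h2 p, ← Finset.sum_div, h1]
    have : (n : ℂ) ≠ 0 := by exact_mod_cast hn0.ne'
    simp only [Fin.ext_iff]
    split_ifs <;> simp [this]
  have hpair : ∀ k : Fin (n / 4), inner ℂ (f pl k) (Matrix.toEuclideanLin X (f mi k)) =
      ∑ p, ∑ q, star (c k p) * c k q * X (pl p) (mi q) := by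
    intro k
    simp only [f, map_sum, map_smul, sum_inner, inner_sum, inner_smul_left, inner_smul_right,
      Finset.mul_sum]
    rw [Finset.sum_comm]
    refine Finset.sum_congr rfl fun p _ => Finset.sum_congr rfl fun q _ => ?_
    simp [Matrix.toLpLin_apply, EuclideanSpace.inner_single_left, mul_assoc, mul_left_comm]
  have hsign : ∀ k : Fin (n / 4), ∑ p, ∑ q, star (c k p) * c k q *
      (b * (SignType.sign ((p : ℤ) - (q : ℤ)) : ℂ)) =
      b * ((1 + rootNegOne n k) / (rootNegOne n k - 1)) := by
    intro k
    have h1 : ∀ p : Fin n, ∑ q : Fin n, star (c k p) * c k q *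
        (b * (SignType.sign ((p : ℤ) - (q : ℤ)) : ℂ)) =
        b * ((1 + rootNegOne n k) / (rootNegOne n k - 1)) / n *
          (star (rootNegOne n k ^ (p : ℕ)) * rootNegOne n k ^ (p : ℕ)) := by
      intro p
      calc _ = b / n * star (rootNegOne n k ^ (p : ℕ)) *
            ∑ q : Fin n, (SignType.sign ((p : ℤ) - (q : ℤ)) : ℂ) * rootNegOne n k ^ (q : ℕ) := by
            rw [Finset.mul_sum]
            refine Finset.sum_congr rfl fun q _ => ?_
            simp only [c, star_div₀, Complex.star_def, Complex.conj_ofReal, ← hr]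
            field_simp
        _ = _ := by
            rw [sum_sign_mul_pow (rootNegOne_pow (by omega) _) (rootNegOne_ne_one (by omega) _)]
            ring
    rw [Finset.sum_congr rfl fun p _ => h1 p, ← Finset.mul_sum,
      sum_star_rootNegOne_pow_mul (n := n) k k (by omega) (by omega), if_pos rfl]
    have : (n : ℂ) ≠ 0 := by exact_mod_cast hn0.ne'
    field_simp
  have hc : ∀ k p, ‖c k p‖ = 1 / √n := by
    intro k p
    simp only [c, norm_div, norm_pow, norm_rootNegOne, one_pow, Complex.norm_real,
      Real.norm_eq_abs, abs_of_nonneg (Real.sqrt_nonneg _)]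
  -- Coefficients of modulus `1/√n` turn an entrywise error `E` into at most `n E` per pairing.
  have hk : ∀ k : Fin (n / 4), b * ‖(1 + rootNegOne n k) / (rootNegOne n k - 1)‖ - n * E ≤
      ‖inner ℂ (f pl k) (Matrix.toEuclideanLin X (f mi k))‖ := by
    intro k
    have h1 : ‖inner ℂ (f pl k) (Matrix.toEuclideanLin X (f mi k)) -
        b * ((1 + rootNegOne n k) / (rootNegOne n k - 1))‖ ≤ n * E := by
      rw [hpair, ← hsign, ← Finset.sum_sub_distrib]
      calc _ ≤ ∑ _p : Fin n, ∑ _q : Fin n, 1 / n * E := by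
            refine (norm_sum_le _ _).trans (Finset.sum_le_sum fun p _ => ?_)
            rw [← Finset.sum_sub_distrib]
            refine (norm_sum_le _ _).trans (Finset.sum_le_sum fun q _ => ?_)
            rw [← mul_sub, norm_mul, norm_mul, norm_star, hc, hc, div_mul_div_comm,
              Real.mul_self_sqrt hn0.le, one_mul]
            gcongr
            exact hX p q
        _ = n * E := by
            simp only [Finset.sum_const, Finset.card_univ, Fintype.card_fin, nsmul_eq_mul]
            field_simp
    have h2 := norm_sub_norm_le (b * ((1 + rootNegOne n k) / (rootNegOne n k - 1)) : ℂ)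
      (inner ℂ (f pl k) (Matrix.toEuclideanLin X (f mi k)))
    rw [norm_sub_rev, norm_mul, Complex.norm_real, Real.norm_eq_abs, abs_of_nonneg hb] at h2
    linarith
  have hcard : ((n / 4 : ℕ) : ℝ) ≤ n := by exact_mod_cast Nat.div_le_self n 4
  calc b * (n * Real.log n / (4 * Real.pi)) - n ^ 2 * E
      ≤ b * ∑ k : Fin (n / 4), ‖(1 + rootNegOne n k) / (rootNegOne n k - 1)‖ -
        (n / 4 : ℕ) * (n * E) := by
        have := mul_le_mul_of_nonneg_left (mul_log_le_sum_norm hn) hb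
        have h2 : ((n / 4 : ℕ) : ℝ) * (n * E) ≤ n * (n * E) := by gcongr
        nlinarith
    _ = ∑ k : Fin (n / 4),
        (b * ‖(1 + rootNegOne n k) / (rootNegOne n k - 1)‖ - n * E) := by
        rw [Finset.sum_sub_distrib, Finset.mul_sum]
        simp
    _ ≤ _ := Finset.sum_le_sum fun k _ => hk k
    _ ≤ _ := sum_norm_inner_le_schattenNorm_one X (hortho pl hpl) (hortho mi hmi)

/-! ### The perturbation and the choice of scales -/

/-- The Hermitian matrix whose only nonzero entries are `v` in the row and column of `o`. -/
def arrowMatrix {m : Type*} [DecidableEq m] (o : m) (v : m → ℝ) : Matrix m m ℂ :=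
  Matrix.of fun i j => if i = o then (v j : ℂ) else if j = o then (v i : ℂ) else 0

section

variable {m : Type*} [DecidableEq m] (o : m) (v : m → ℝ)

lemma arrowMatrix_isHermitian (hv : v o = 0) : (arrowMatrix o v).IsHermitian := by
  ext i j
  by_cases hi : i = o <;> by_cases hj : j = o <;>
    simp [arrowMatrix, Matrix.conjTranspose_apply, hi, hj, hv]

variable [Fintype m]

lemma arrowMatrix_mulVec_single {j : m} (hj : j ≠ o) :
    arrowMatrix o v *ᵥ Pi.single j 1 = (v j : ℂ) • Pi.single o 1 := by
  ext i
  by_cases hi : i = o <;> simp [arrowMatrix, hi, hj]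

lemma arrowMatrix_mulVec_single_self (hv : v o = 0) :
    arrowMatrix o v *ᵥ Pi.single o 1 = fun i => (v i : ℂ) := by
  ext i
  by_cases hi : i = o <;> simp [arrowMatrix, hi, hv]

lemma schattenNorm_two_arrowMatrix_le : schattenNorm 2 (arrowMatrix o v) ≤ √(2 * ∑ i, v i ^ 2) := by
  rw [schattenNorm_two]
  apply Real.sqrt_le_sqrt
  calc _ ≤ ∑ r, ∑ s, ((if r = o then v s ^ 2 else 0) + if s = o then v r ^ 2 else 0) := by
        refine Finset.sum_le_sum fun r _ => Finset.sum_le_sum fun s _ => ?_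
        by_cases hr : r = o <;> by_cases hs : s = o <;> simp [arrowMatrix, hr, hs, sq_nonneg]
    _ = _ := by
        simp only [Finset.sum_add_distrib]
        rw [Finset.sum_comm]
        simp [two_mul]

end

/-- Distinct powers differ by a factor of at least `t`, so the larger one dominates; for `p = q`
both terms are `0`. -/
lemma abs_pow_sub_pow_div_sub_sign_le {t : ℝ} (ht : 2 ≤ t) (p q : ℕ) :
    |(t ^ (p + 1) - t ^ (q + 1)) / (t ^ (p + 1) + t ^ (q + 1)) -
      (SignType.sign ((p : ℤ) - (q : ℤ)) : ℝ)| ≤ 2 / t := by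
  have ht0 : 0 < t := by linarith
  have h1 : ∀ a b : ℕ, a < b → t ^ (a + 1) * t ≤ t ^ (b + 1) := by
    intro a b hab
    rw [← pow_succ]
    exact pow_le_pow_right₀ (by linarith) (by omega)
  have hp := pow_pos ht0 (p + 1)
  have hq := pow_pos ht0 (q + 1)
  rcases lt_trichotomy p q with h | h | h
  · rw [sign_neg (by omega)]
    have e : (t ^ (p + 1) - t ^ (q + 1)) / (t ^ (p + 1) + t ^ (q + 1)) -
        ((-1 : SignType) : ℝ) = 2 * t ^ (p + 1) / (t ^ (p + 1) + t ^ (q + 1)) := by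
      simp only [SignType.coe_neg, SignType.coe_one]
      generalize t ^ (p + 1) = x at *
      field_simp; ring
    rw [e, abs_of_pos (by positivity), div_le_div_iff₀ (by positivity) ht0]
    linarith [h1 p q h]
  · subst h
    simp
    positivity
  · rw [sign_pos (by omega)]
    have e : (t ^ (p + 1) - t ^ (q + 1)) / (t ^ (p + 1) + t ^ (q + 1)) -
        ((1 : SignType) : ℝ) = -(2 * t ^ (q + 1) / (t ^ (p + 1) + t ^ (q + 1))) := by
      simp only [SignType.coe_one]
      generalize t ^ (p + 1) = x at *
      field_simp; ring
    rw [e, abs_neg, abs_of_pos (by positivity), div_le_div_iff₀ (by positivity) ht0]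
    linarith [h1 q p h]

/-- The block of the Schur multiplier of `g^[2]` between the eigenvalues `t ^ (p + 1)` and
`-t ^ (q + 1)` approaches a multiple of the sign matrix. -/
lemma norm_bilinearSchurMultiplier_arrowMatrix_sub_le {g : ℝ → ℝ}
    (hout : ∀ x, 1 < |x| → g x = x * |x|) (hsq : ∀ x, |g x| ≤ x ^ 2) (h0 : g 0 = 0)
    (hd : deriv g 0 = 0) {m : Type*} [Fintype m] [DecidableEq m] (o : m) (μ v : m → ℝ)
    (hμo : μ o = 0) (hvo : v o = 0) {i j : m} {t β : ℝ} (ht : 2 ≤ t) (hβ : 0 < β) {p q : ℕ}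
    (hμi : μ i = t ^ (p + 1)) (hμj : μ j = -t ^ (q + 1)) (hvi : v i = β) (hvj : v j = β)
    (hA : (Matrix.diagonal fun r => (μ r : ℂ)).IsHermitian) (hB : (arrowMatrix o v).IsHermitian) :
    ‖bilinearSchurMultiplier (fun x₀ x₁ x₂ => (dividedDiff2 g x₀ x₁ x₂ : ℂ)) (hA.add hB) hA hA
        (arrowMatrix o v) (arrowMatrix o v) i j -
        (β ^ 2 : ℝ) * (SignType.sign ((p : ℤ) - (q : ℤ)) : ℂ)‖ ≤
      (4 * β * ((β + 1) * √(∑ r, v r ^ 2)) + 2 * β ^ 2) / t := by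
  have ht0 : 0 < t := by linarith
  have hio : i ≠ o := by rintro rfl; linarith
  have hjo : j ≠ o := by rintro rfl; linarith
  have hpow : ∀ k : ℕ, t ≤ t ^ (k + 1) := fun k => le_self_pow₀ (by linarith) (by omega)
  have hdiag : ∀ r, (Matrix.diagonal fun r => (μ r : ℂ)) *ᵥ Pi.single r 1 =
      (μ r : ℂ) • Pi.single r 1 := by
    intro r
    rw [Matrix.diagonal_mulVec_single, mul_one]
    ext s
    simp [Pi.single_apply]
  have hT := congrFun (bilinearSchurMultiplier_mulVec
    (fun x₀ x₁ x₂ => (dividedDiff2 g x₀ x₁ x₂ : ℂ)) (hA.add hB) hA hA (arrowMatrix o v)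
    (arrowMatrix o v) (hdiag j)
    (arrowMatrix_mulVec_single o v hjo) (hdiag o)) i
  rw [Matrix.mulVec_single_one, Matrix.col_apply, arrowMatrix_mulVec_single_self o v hvo, hμo,
    hμj, hvj] at hT
  set s : ℝ := (t ^ (p + 1) - t ^ (q + 1)) / (t ^ (p + 1) + t ^ (q + 1)) with hs
  have hF : ∀ x, ‖(dividedDiff2 g x 0 (-t ^ (q + 1)) : ℂ) - (s : ℂ)‖ ≤
      4 / t * (|x - μ i| + 1) := by
    intro x
    rw [← Complex.ofReal_sub, Complex.norm_real, Real.norm_eq_abs, hμi]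
    refine (abs_dividedDiff2_sub_le hout hsq h0 hd (ht.trans (hpow q))
      (pow_pos ht0 (p + 1))).trans ?_
    gcongr
    exact hpow q
  have hest := norm_inner_sum_smul_rankOneProj_sub_le (hA.add hB) _ (s : ℂ) hF (by positivity)
    (Pi.single i 1) (fun r => (v r : ℂ))
  -- The residual of `e_i` has norm `β` whatever `t` is, so the factor `4 / t` makes the error
  -- small.
  have hHi : (Matrix.diagonal (fun r => (μ r : ℂ)) + arrowMatrix o v) *ᵥ Pi.single i 1 -
      (μ i : ℂ) • Pi.single i 1 = (β : ℂ) • Pi.single o 1 := by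
    rw [Matrix.add_mulVec, hdiag, arrowMatrix_mulVec_single o v hio, hvi, add_sub_cancel_left]
  have hV : ‖(WithLp.toLp 2 (fun r => (v r : ℂ)) : EuclideanSpace ℂ m)‖ = √(∑ r, v r ^ 2) := by
    rw [EuclideanSpace.norm_eq]
    simp
  rw [hHi, WithLp.toLp_smul, norm_smul, hV, Complex.norm_real, Real.norm_eq_abs, abs_of_pos hβ,
    PiLp.toLp_single, PiLp.toLp_single, PiLp.norm_single, PiLp.norm_single,
    EuclideanSpace.inner_single_left, EuclideanSpace.inner_single_left] at hest
  simp only [map_one, one_mul, norm_one, mul_one, hvi] at hest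
  simp only [Complex.coe_smul] at hT
  have hsign := abs_pow_sub_pow_div_sub_sign_le ht p q
  set σ : ℝ := (SignType.sign ((p : ℤ) - (q : ℤ)) : ℝ) with hσ
  have hσc : (SignType.sign ((p : ℤ) - (q : ℤ)) : ℂ) = (σ : ℂ) := by
    rw [hσ]; cases SignType.sign ((p : ℤ) - (q : ℤ)) <;> simp
  rw [hT, hσc]
  set S : ℂ := (∑ r, (dividedDiff2 g ((hA.add hB).eigenvalues r) 0 (-t ^ (q + 1)) : ℂ) •
    rankOneProj ((hA.add hB).eigenvectorBasis r) *ᵥ fun r => (v r : ℂ)) i with hS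
  have hest' : ‖S - s * β‖ ≤ 4 / t * ((β + 1) * √(∑ r, v r ^ 2)) := hest
  -- Two errors: replacing `F(A + B)` by the number `s`, and replacing `s` by the sign.
  calc _ = ‖(β : ℂ) * (S - s * β) + ((β ^ 2 * (s - σ) : ℝ) : ℂ)‖ := by
        congr 1
        rw [hS]
        push_cast
        simp
        ring
    _ ≤ β * (4 / t * ((β + 1) * √(∑ r, v r ^ 2))) + β ^ 2 * (2 / t) := by
        refine (norm_add_le _ _).trans (add_le_add ?_ ?_)
        · rw [norm_mul, Complex.norm_real, Real.norm_eq_abs, abs_of_pos hβ]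
          gcongr
        · rw [Complex.norm_real, Real.norm_eq_abs, abs_mul, abs_of_nonneg (sq_nonneg β)]
          gcongr
    _ = _ := by ring

lemma exists_isHermitian_log_le_schattenNorm_one {g : ℝ → ℝ}
    (hout : ∀ x, 1 < |x| → g x = x * |x|) (hsq : ∀ x, |g x| ≤ x ^ 2) (h0 : g 0 = 0)
    (hd : deriv g 0 = 0) {n : ℕ} (hn : 16 ≤ n) {α : ℝ} (hα : 0 < α) :
    ∃ (A B : Matrix (Fin (8 * n + 4)) (Fin (8 * n + 4)) ℂ) (hA : A.IsHermitian)
      (hB : B.IsHermitian), schattenNorm 2 B ≤ 4 * α ∧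
        1 / (2 * Real.pi) * α ^ 2 * Real.log n ≤
          schattenNorm 1 (bilinearSchurMultiplier
            (fun x₀ x₁ x₂ => (dividedDiff2 g x₀ x₁ x₂ : ℂ)) (hA.add hB) hA hA B B) := by
  have hn0 : (0 : ℝ) < n := by exact_mod_cast (by omega : 0 < n)
  have hlog : 0 < Real.log n := Real.log_pos (by exact_mod_cast (by omega : 1 < n))
  -- Chosen so that `‖B‖_2² ≤ 2 · 2n · β² = 16 α²`.
  set β : ℝ := 2 * α / √n with hβ
  have hβ0 : 0 < β := by positivity
  have hβ2 : β ^ 2 = 4 * α ^ 2 / n := by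
    rw [hβ, div_pow, Real.sq_sqrt hn0.le]; ring
  let v : Fin (8 * n + 4) → ℝ := fun i => if 1 ≤ (i : ℕ) ∧ (i : ℕ) ≤ 2 * n then β else 0
  have hv2 : ∑ i, v i ^ 2 ≤ 8 * α ^ 2 := by
    have hcard : (Finset.univ.filter
        fun i : Fin (8 * n + 4) => 1 ≤ (i : ℕ) ∧ (i : ℕ) ≤ 2 * n).card ≤ 2 * n := by
      calc _ ≤ (Finset.Icc 1 (2 * n)).card :=
            Finset.card_le_card_of_injOn Fin.val (by intro i; simp)
              Fin.val_injective.injOn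
        _ = 2 * n := by simp
    have hcard' : ((Finset.univ.filter
        fun i : Fin (8 * n + 4) => 1 ≤ (i : ℕ) ∧ (i : ℕ) ≤ 2 * n).card : ℝ) ≤ 2 * n := by
      exact_mod_cast hcard
    calc ∑ i, v i ^ 2 = ∑ i : Fin (8 * n + 4),
          if 1 ≤ (i : ℕ) ∧ (i : ℕ) ≤ 2 * n then β ^ 2 else 0 := by
          refine Finset.sum_congr rfl fun i _ => ?_
          simp only [v]
          split_ifs <;> simp
      _ = (Finset.univ.filter
        fun i : Fin (8 * n + 4) => 1 ≤ (i : ℕ) ∧ (i : ℕ) ≤ 2 * n).card * β ^ 2 := by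
          rw [← Finset.sum_filter, Finset.sum_const, nsmul_eq_mul]
      _ ≤ 2 * n * β ^ 2 := by gcongr
      _ = 8 * α ^ 2 := by rw [hβ2]; field_simp; ring
  set D : ℝ := 4 * β * ((β + 1) * √(∑ r, v r ^ 2)) + 2 * β ^ 2 with hD
  have hD0 : 0 < D := by positivity
  -- `D` does not involve `t`, so `t` may be taken last, large enough that the total error `n² D /
  -- t` is at most the target bound.
  set t : ℝ := max 2 (n ^ 2 * D / (1 / (2 * Real.pi) * α ^ 2 * Real.log n)) with ht
  have ht2 : 2 ≤ t := le_max_left _ _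
  have ht0 : 0 < t := by linarith
  have hDt : n ^ 2 * (D / t) ≤ 1 / (2 * Real.pi) * α ^ 2 * Real.log n := by
    have h1 : n ^ 2 * D / (1 / (2 * Real.pi) * α ^ 2 * Real.log n) ≤ t := le_max_right _ _
    rw [div_le_iff₀ (by positivity)] at h1
    rw [← mul_div_assoc, div_le_iff₀ ht0]
    linarith
  -- Index `0` is the centre of the arrow. Indices beyond `2n` are padding, met neither by `v` nor
  -- by the block.
  let μ : Fin (8 * n + 4) → ℝ := fun i => if (i : ℕ) = 0 then 0 else
    if (i : ℕ) ≤ n then t ^ (i : ℕ) else -t ^ ((i : ℕ) - n)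
  let pl : Fin n → Fin (8 * n + 4) := fun p => ⟨p + 1, by omega⟩
  let mi : Fin n → Fin (8 * n + 4) := fun q => ⟨n + q + 1, by omega⟩
  have hvo : v 0 = 0 := by simp [v]
  have hA : (Matrix.diagonal fun r => (μ r : ℂ)).IsHermitian :=
    Matrix.isHermitian_diagonal_of_self_adjoint _ (by ext r; simp)
  refine ⟨_, arrowMatrix 0 v, hA, arrowMatrix_isHermitian 0 v hvo, ?_, ?_⟩
  · refine (schattenNorm_two_arrowMatrix_le 0 v).trans (Real.sqrt_le_iff.2 ⟨by positivity, ?_⟩)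
    nlinarith
  · have hblock : ∀ p q : Fin n, ‖bilinearSchurMultiplier
        (fun x₀ x₁ x₂ => (dividedDiff2 g x₀ x₁ x₂ : ℂ))
        (hA.add (arrowMatrix_isHermitian 0 v hvo)) hA hA (arrowMatrix 0 v) (arrowMatrix 0 v)
        (pl p) (mi q) - (β ^ 2 : ℝ) * (SignType.sign ((p : ℤ) - (q : ℤ)) : ℂ)‖ ≤ D / t := by
      intro p q
      refine norm_bilinearSchurMultiplier_arrowMatrix_sub_le hout hsq h0 hd 0 μ v ?_ hvo ht2 hβ0
        ?_ ?_ ?_ ?_ hA (arrowMatrix_isHermitian 0 v hvo)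
      · simp [μ]
      · simp [μ, pl]
      · have h1 : n + (q : ℕ) + 1 - n = q + 1 := by omega
        have h2 : ¬ n + (q : ℕ) + 1 ≤ n := by omega
        simp [μ, mi, h1, h2]
      · have : (p : ℕ) + 1 ≤ 2 * n := by omega
        simp [v, pl, this]
      · have : n + (q : ℕ) + 1 ≤ 2 * n := by omega
        simp [v, mi, this]
    have hpl : Function.Injective pl := by
      intro p q h
      simpa [pl, Fin.ext_iff] using h
    have hmi : Function.Injective mi := by
      intro p q h
      simpa [mi, Fin.ext_iff] using h
    refine le_trans ?_ (mul_log_sub_le_schattenNorm_one hn hpl hmi _ (sq_nonneg β) hblock)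
    -- The main term is twice the target, leaving one half for the error.
    have h1 : β ^ 2 * (n * Real.log n / (4 * Real.pi)) =
        2 * (1 / (2 * Real.pi) * α ^ 2 * Real.log n) := by
      rw [hβ2]
      field_simp
    linarith

theorem mainTheorem5 :
    ∃ (c : ℝ) (g : ℝ → ℝ) (N : ℕ),
      0 < c ∧ 1 ≤ N ∧
      ContDiff ℝ 2 g ∧
      (∃ M : ℝ, ∀ x : ℝ, |iteratedDeriv 2 g x| ≤ M) ∧
      (∀ x : ℝ, 1 < |x| → g x = x * |x|) ∧
      g 0 = 0 ∧ deriv g 0 = 0 ∧ iteratedDeriv 2 g 0 = 0 ∧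
      ∀ α : ℕ → ℝ, (∀ n : ℕ, N ≤ n → 0 < α n) →
        ∃ A B : (n : ℕ) → Matrix (Fin (8 * n + 4)) (Fin (8 * n + 4)) ℂ,
          ∀ n : ℕ, N ≤ n →
            ∃ (hA : (A n).IsHermitian) (hB : (B n).IsHermitian),
              schattenNorm 2 (B n) ≤ 4 * α n ∧
              c * (α n) ^ 2 * Real.log (n : ℝ) ≤
                schattenNorm 1
                  (bilinearSchurMultiplier (fun x₀ x₁ x₂ => (dividedDiff2 g x₀ x₁ x₂ : ℂ))
                    (hA.add hB) hA hA (B n) (B n)) := by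
  obtain ⟨g, hC, hM, hout, hsq, h0, hd, hdd⟩ := exists_contDiff_eq_mul_abs
  refine ⟨1 / (2 * Real.pi), g, 16, by positivity, by norm_num, hC, hM, hout, h0, hd, hdd,
    fun α hα => ?_⟩
  have key := fun n (hn : 16 ≤ n) =>
    exists_isHermitian_log_le_schattenNorm_one hout hsq h0 hd hn (hα n hn)
  choose! A B h using key
  exact ⟨A, B, h⟩
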